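/- Let $\sigma:\{1,2,\dots\}\to\mathbb{N}$ be well-behaved: $\sigma(h)\le h$, $\sigma(1)=1$, and both $\sigma(h)$ and $h-\sigma(h)$ are non-decreasing in $h$. A move of $\sigma$-Bulgarian solitaire on a partition $\lambda=(\lambda_1\ge\lambda_2\ge\cdots)$ of $n$ removes $\sigma(\lambda_i)$ cards from each pile $\lambda_i$, and the removed cards form a new pile (piles are then re-sorted and empty piles discarded). A partition $\lambda$ is stable if a move leaves it unchanged, and recurrent if some positive number of moves leads from $\lambda$ back to $\lambda$. For a partition $\lambda$ of $n\ge 1$ put $\lambda_i=0$ beyond the last part, and let its downscaled boundary function be $\partial^{\downarrow}\lambda(x)=\frac1{\lambda_1}\lambda_{\lfloor xn/\lambda_1\rfloor+1}$ for $x\ge0$. Let $\sigma_1,\sigma_2,\dots$ be well-behaved and let $\phi:\mathbb{R}_{\ge0}\to\mathbb{R}_{\ge0}$. We say that $\phi$ is a limit shape of recurrent configurations of $(\sigma_n)$ if, for every choice of recurrent partitions $\lambda^{(n)}$ of $n$ with respect to $\sigma_n$ ($n\ge1$), $\partial^{\downarrow}\lambda^{(n)}(x)\to\phi(x)$ as $n\to\infty$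 for all $x>0$. We say that $\phi$ is a limit shape of stable configurations of $(\sigma_n)$ if $\partial^{\downarrow}\lambda^{(n^*(n))}(x)\to\phi(x)$ as $n\to\infty$ for all $x>0$, where $n^*(n)$ is the largest $n'\le n$ for which $\sigma_n$-solitaire has a stable configuration of $n'$ cards, and $\lambda^{(n^*(n))}$ is that (unique) stable configuration. Theorem. Let $q_n\in(0,1]$ for $n\ge1$, and let $\sigma_n(h)=\lceil q_nh\rceil$ ($q_n$-proportion Bulgarian solitaire). (a) If $q_n^2n\to0$, then the triangular shape $\phi(x)=\max(1-x/2,0)$ is a limit shape both of stable configurations and of recurrent configurations of $(\sigma_n)$. (b) If $q_n\to0$ and $q_n^2n\to\infty$, then the exponential shape $\phi(x)=e^{-x}$ is a limit shape both of stable configurations and of recurrent configurations of $(\sigma_n)$. In particular, in each of the cases (a) and (b), every limit shape of stable configurations of $(\sigma_n)$ is also a limit shape of recurrent configurations of $(\sigma_n)$. -/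

import Mathlib

open Filter Topology
open scoped NNReal

/-- A well-behaved pick function `σ`: from a pile of `h` cards one picks `σ h ≤ h` cards, `σ 1 = 1`,
and both `σ` and `h ↦ h - σ h` are non-decreasing.  (The value at `0` is forced to be `0`, so
monotonicity on `ℕ` is the same as monotonicity on the positive integers.) -/
structure WellBehavedRule where
  pick : ℕ → ℕ
  pick_le : ∀ h, pick h ≤ h
  pick_one : pick 1 = 1
  pick_mono : Monotone pick
  rest_mono : Monotone fun h => h - pick h

namespace WellBehavedRule

theorem move_sum (σ : WellBehavedRule) {n : ℕ} (lam : Nat.Partition n) :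
    (lam.parts.map (fun h => h - σ.pick h) + {(lam.parts.map σ.pick).sum}).sum = n := by
  rw [Multiset.sum_add, Multiset.sum_singleton, ← Multiset.sum_map_add]
  have h : lam.parts.map (fun h => h - σ.pick h + σ.pick h) = lam.parts.map id :=
    Multiset.map_congr rfl fun h _ => Nat.sub_add_cancel (σ.pick_le h)
  rw [h, Multiset.map_id, lam.parts_sum]

/-- One move of the `σ`-Bulgarian solitaire on configurations of `n` cards: `σ h` cards are picked
from every pile of size `h`, and all picked cards form a new pile (empty piles are discarded). -/
def move (σ : WellBehavedRule) {n : ℕ} (lam : Nat.Partition n) : Nat.Partition n :=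
  Nat.Partition.ofSums n
    (lam.parts.map (fun h => h - σ.pick h) + {(lam.parts.map σ.pick).sum}) (σ.move_sum lam)

/-- A configuration is stable if a move leaves it unchanged. -/
def IsStable (σ : WellBehavedRule) {n : ℕ} (lam : Nat.Partition n) : Prop :=
  σ.move lam = lam

/-- A configuration is recurrent if some positive number of moves leads back to it. -/
def IsRecurrent (σ : WellBehavedRule) {n : ℕ} (lam : Nat.Partition n) : Prop :=
  ∃ k : ℕ, 0 < k ∧ σ.move^[k] lam = lam

open Classical in
/-- `n*`: the largest `m ≤ n` such that there is a stable configuration of `m` cards. -/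
noncomputable def nStar (σ : WellBehavedRule) (n : ℕ) : ℕ :=
  Nat.findGreatest (fun m => ∃ lam : Nat.Partition m, σ.IsStable lam) n

/-- There is always a stable configuration on `n*` cards. -/
theorem exists_isStable_nStar (σ : WellBehavedRule) (n : ℕ) :
    ∃ lam : Nat.Partition (σ.nStar n), σ.IsStable lam := by
  classical
  have h0 : ∃ lam : Nat.Partition 0, σ.IsStable lam :=
    ⟨default, Subsingleton.elim _ _⟩
  exact Nat.findGreatest_spec (P := fun m => ∃ lam : Nat.Partition m, σ.IsStable lam)
    (Nat.zero_le n) h0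

end WellBehavedRule

/-- `pile lam i` is the size of the `(i+1)`-st largest pile of `lam` (and `0` beyond the last). -/
def pile {n : ℕ} (lam : Nat.Partition n) (i : ℕ) : ℕ :=
  (lam.parts.sort (· ≥ ·)).getD i 0

/-- The diagram-boundary function `x ↦ lam_{⌊x⌋+1}`. -/
noncomputable def boundary {n : ℕ} (lam : Nat.Partition n) (x : ℝ≥0) : ℝ≥0 :=
  (pile lam ⌊x⌋₊ : ℝ≥0)

/-- The downscaled diagram-boundary function `x ↦ lam_{⌊x n / lam_1⌋+1} / lam_1`, which has unit
height and unit area (for `n ≥ 1`). -/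
noncomputable def downscaled {n : ℕ} (lam : Nat.Partition n) (x : ℝ≥0) : ℝ≥0 :=
  boundary lam (x * n / (pile lam 0 : ℝ≥0)) / (pile lam 0 : ℝ≥0)

/-- `φ` is a limit shape of the recurrent configurations of the `σ n`-solitaires on `n` cards,
`n = 1, 2, …`. -/
def IsRecurrentLimitShape (σ : ℕ → WellBehavedRule) (φ : ℝ≥0 → ℝ≥0) : Prop :=
  ∀ lam : ∀ n : ℕ, Nat.Partition n, (∀ n, 1 ≤ n → (σ n).IsRecurrent (lam n)) →
    ∀ x : ℝ≥0, 0 < x → Tendsto (fun n => downscaled (lam n) x) atTop (𝓝 (φ x))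

/-- `φ` is a limit shape of the stable configurations of the `σ n`-solitaires: for each `n` one
takes the (unique) stable configuration of the `σ n`-solitaire on `n*(n)` cards. -/
def IsStableLimitShape (σ : ℕ → WellBehavedRule) (φ : ℝ≥0 → ℝ≥0) : Prop :=
  ∀ lam : ∀ n : ℕ, Nat.Partition ((σ n).nStar n), (∀ n, 1 ≤ n → (σ n).IsStable (lam n)) →
    ∀ x : ℝ≥0, 0 < x → Tendsto (fun n => downscaled (lam n) x) atTop (𝓝 (φ x))

/-- The rule `σ h = ⌈q h⌉` of the `q`-proportion Bulgarian solitaire, `0 < q ≤ 1`. -/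
noncomputable def proportionRule (q : ℝ) (hq : q ∈ Set.Ioc (0 : ℝ) 1) : WellBehavedRule where
  pick h := ⌈q * (h : ℝ)⌉₊
  pick_le h := by
    rw [Nat.ceil_le]
    exact mul_le_of_le_one_left (Nat.cast_nonneg h) hq.2
  pick_one := by
    rw [Nat.cast_one, mul_one, Nat.ceil_eq_iff one_ne_zero]
    simpa using hq
  pick_mono a b hab := by
    have h : (a : ℝ) ≤ b := by exact_mod_cast hab
    exact Nat.ceil_mono (mul_le_mul_of_nonneg_left h hq.1.le)
  rest_mono := by
    refine monotone_nat_of_le_succ fun h => ?_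
    have h1 : ⌈q * ((h + 1 : ℕ) : ℝ)⌉₊ ≤ ⌈q * (h : ℝ)⌉₊ + 1 := by
      rw [Nat.ceil_le]
      push_cast
      have := Nat.le_ceil (q * (h : ℝ))
      have := hq.2
      linarith
    show h - ⌈q * (h : ℝ)⌉₊ ≤ h + 1 - ⌈q * ((h + 1 : ℕ) : ℝ)⌉₊
    omega

/-- The triangle of height `1` and width `2`: `x ↦ max (1 - x/2) 0`. -/
noncomputable def triangularShape (x : ℝ≥0) : ℝ≥0 :=
  ⟨max (1 - (x : ℝ) / 2) 0, le_max_right _ _⟩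

/-- The exponential shape `x ↦ e^{-x}`. -/
noncomputable def exponentialShape (x : ℝ≥0) : ℝ≥0 :=
  ⟨Real.exp (-(x : ℝ)), (Real.exp_pos _).le⟩

/-!
Write `R h = h - σ h` for what a move leaves of a pile of `h` cards. A recurrent configuration lies
on a periodic orbit, which extends to all integer times. Every pile on it was made by some earlier
move, so if `N t` is the size of the pile made at time `t`, the piles at time `t` are
`R^[k] (N (t - 1 - k))`, `k = 0, 1, …`, and `N` satisfies
`∑ k, σ (R^[k] (N (t - 1 - k))) = N t` and `∑ k, R^[k] (N (t - 1 - k)) = n`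
(`WellBehavedRule.IsRecurrent.exists_pileHistory`). If `lo ≤ N t ≤ hi` for all `t`, then the sorted
piles satisfy `R^[i] lo ≤ pile i ≤ R^[i] hi` for every `i`. Both limit shapes follow once `N` is
known to be nearly constant. For the proportional rule, `q h ≤ σ h ≤ q h + 1` yields
`q n ≤ N t ≤ q n + #piles`.

*Exponential shape.* A pile that survives `k` moves has at least `q k (k + 1) / 2` cards, so there
are at most about `√(2 H / q)` piles when `H` is the largest one. For `x = q H` this gives
`x ≤ q² n + √(2 x) + 1`, and hence all `q N t` lie between `q² n` and `q² n (1 + o(1))` when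
`q² n → ∞` (`mul_pileHistory_le`). Up to rounding errors of total size at most `1 / q`, the
iterate `R^[i]` is multiplication by `(1 - q) ^ i`.

*Triangular shape.* The number `ℓ` of piles grows by at most one per move and bounds `N` from below,
so the pile made `k` moves ago still has about `ℓ - 2 k` cards, whence `ℓ² / 4 ≤ n`
(`sq_half_numPiles_le`). When `q² n` is small, all piles are therefore below `1 / q` and lose one
card per move, as in ordinary Bulgarian solitaire. There `N` takes at most two consecutive values,
by an arithmetic argument on the periods of its maximal and minimal times
(`exists_forall_mem_Icc_of_bulgarian`), so the configuration is a staircase up to one diagonal.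

*Stable configurations* are recurrent, and there is one with `R^[k] h` as its piles for every `h`.
The sizes of these at most double, up to one card, from `h` to `h + 1`, so `n ≤ 2 n* + 1`, and the
hypotheses on `q² n` pass to `q² n*`.
-/

/-! ### Piles shrinking under a rule -/

namespace WellBehavedRule

variable (σ : WellBehavedRule)

/-- What a move leaves of a pile of size `h`. -/
def rest (h : ℕ) : ℕ := h - σ.pick h

theorem pick_zero : σ.pick 0 = 0 := Nat.le_zero.1 (σ.pick_le 0)

theorem one_le_pick {h : ℕ} (hh : h ≠ 0) : 1 ≤ σ.pick h :=
  σ.pick_one ▸ σ.pick_mono (Nat.one_le_iff_ne_zero.2 hh)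

theorem rest_zero : σ.rest 0 = 0 := by simp [rest]

theorem rest_add_pick (h : ℕ) : σ.rest h + σ.pick h = h := Nat.sub_add_cancel (σ.pick_le h)

theorem monotone_rest : Monotone σ.rest := σ.rest_mono

theorem rest_add_one_le (h : ℕ) : σ.rest (h + 1) ≤ σ.rest h + 1 := by
  have h1 := σ.pick_mono (Nat.le_succ h)
  simp only [Nat.succ_eq_add_one] at h1
  unfold rest
  omega

theorem rest_le_sub_one (h : ℕ) : σ.rest h ≤ h - 1 := by
  rcases eq_or_ne h 0 with rfl | hh
  · simp [rest]
  · have := σ.one_le_pick hh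
    unfold rest
    omega

theorem monotone_iterate_rest (k : ℕ) : Monotone (σ.rest^[k]) := σ.monotone_rest.iterate k

theorem iterate_rest_le_sub (k h : ℕ) : σ.rest^[k] h ≤ h - k := by
  induction k with
  | zero => simp
  | succ k ih =>
    rw [Function.iterate_succ_apply']
    have := σ.rest_le_sub_one (σ.rest^[k] h)
    omega

theorem iterate_rest_eq_zero {k h : ℕ} (hk : h ≤ k) : σ.rest^[k] h = 0 := by
  have := σ.iterate_rest_le_sub k h
  omega

theorem antitone_iterate_rest (h : ℕ) : Antitone fun k => σ.rest^[k] h := by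
  refine antitone_nat_of_succ_le fun k => ?_
  rw [Function.iterate_succ_apply']
  exact (σ.rest_le_sub_one _).trans (Nat.sub_le _ _)

theorem iterate_rest_add_one_le (k h : ℕ) : σ.rest^[k] (h + 1) ≤ σ.rest^[k] h + 1 := by
  induction k with
  | zero => simp
  | succ k ih =>
    rw [Function.iterate_succ_apply', Function.iterate_succ_apply']
    exact (σ.monotone_rest ih).trans (σ.rest_add_one_le _)

end WellBehavedRule

/-! ### Moves on multisets of piles -/

theorem filter_ne_zero_map_filter {f : ℕ → ℕ} (hf : f 0 = 0) (M : Multiset ℕ) :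
    ((M.filter (· ≠ 0)).map f).filter (· ≠ 0) = (M.map f).filter (· ≠ 0) := by
  induction M using Multiset.induction with
  | empty => simp
  | cons a M ih =>
    rcases eq_or_ne a 0 with rfl | ha
    · simpa [hf] using ih
    · rw [Multiset.filter_cons_of_pos (p := (· ≠ 0)) _ ha, Multiset.map_cons, Multiset.map_cons,
        Multiset.filter_cons, Multiset.filter_cons, ih]

theorem sum_map_filter_ne_zero {f : ℕ → ℕ} (hf : f 0 = 0) (M : Multiset ℕ) :
    ((M.filter (· ≠ 0)).map f).sum = (M.map f).sum := by
  induction M using Multiset.induction with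
  | empty => simp
  | cons a M ih =>
    rcases eq_or_ne a 0 with rfl | ha
    · simpa [hf] using ih
    · rw [Multiset.filter_cons_of_pos (p := (· ≠ 0)) _ ha, Multiset.map_cons, Multiset.map_cons,
        Multiset.sum_cons, Multiset.sum_cons, ih]

theorem map_range_succ_eq_cons {α : Type*} (f : ℕ → α) (n : ℕ) :
    (Multiset.range (n + 1)).map f = f 0 ::ₘ (Multiset.range n).map fun k => f (k + 1) := by
  induction n with
  | zero => simp
  | succ n ih =>
    rw [Multiset.range_succ, Multiset.map_cons, ih, Multiset.range_succ, Multiset.map_cons,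
      Multiset.cons_swap]

theorem filter_parts_ne_zero {n : ℕ} (lam : Nat.Partition n) :
    lam.parts.filter (· ≠ 0) = lam.parts :=
  Multiset.filter_eq_self.2 fun _ ha => (lam.parts_pos ha).ne'

namespace WellBehavedRule

variable (σ : WellBehavedRule)

/-- A move can be computed on any list of the piles, with empty piles allowed. -/
theorem parts_move_of_parts_eq {n : ℕ} {lam : Nat.Partition n} {M : Multiset ℕ}
    (hM : lam.parts = M.filter (· ≠ 0)) :
    (σ.move lam).parts = ((M.map σ.pick).sum ::ₘ M.map σ.rest).filter (· ≠ 0) := by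
  have h1 : (σ.move lam).parts =
      (lam.parts.map σ.rest + {(lam.parts.map σ.pick).sum}).filter (· ≠ 0) := rfl
  rw [h1, hM, sum_map_filter_ne_zero σ.pick_zero, Multiset.filter_add,
    filter_ne_zero_map_filter σ.rest_zero, ← Multiset.filter_add, add_comm,
    Multiset.singleton_add]

/-! ### The piles of a recurrent configuration -/

/-- The piles after `j` moves, sorted by age: the piles made during these moves, followed by what
is left of the original piles. -/
theorem parts_orbit {n : ℕ} (L : ℤ → Nat.Partition n) (hL : ∀ t, L (t + 1) = σ.move (L t))
    (s : ℤ) (j : ℕ) :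
    (L (s + j)).parts =
      ((Multiset.range j).map (fun k : ℕ =>
          σ.rest^[k] (((L (s + j - 1 - k)).parts.map σ.pick).sum)) +
        (L s).parts.map (σ.rest^[j])).filter (· ≠ 0) := by
  induction j with
  | zero => simpa using (filter_parts_ne_zero (L s)).symm
  | succ j ih =>
    have h2 : s + ((j + 1 : ℕ) : ℤ) = (s + j) + 1 := by push_cast; ring
    have h1 := σ.parts_move_of_parts_eq ih
    rw [h2, hL, h1, ← sum_map_filter_ne_zero σ.pick_zero, ← ih]
    congr 1
    rw [map_range_succ_eq_cons, Multiset.map_add, Multiset.map_map, Multiset.map_map,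
      ← Multiset.cons_add]
    congr 1
    · congr 1
      · simp
      · refine Multiset.map_congr rfl fun k _ => ?_
        rw [Function.comp_apply, ← Function.iterate_succ_apply' σ.rest]
        congr 5
        push_cast
        ring
    · refine Multiset.map_congr rfl fun k _ => ?_
      rw [Function.comp_apply, ← Function.iterate_succ_apply' σ.rest]

/-- The new piles along a periodic orbit of configurations of `n` cards: `N t` is the size of the
pile made by the move at time `t`. A pile of age `k` at time `t` was made at time `t - 1 - k`, and
no pile gets older than `n`. -/
structure IsPileHistory (n : ℕ) (N : ℤ → ℕ) : Prop where
  periodic : ∃ K : ℕ, 0 < K ∧ ∀ t, N (t + K) = N t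
  sum_rest : ∀ t : ℤ, ∑ k ∈ Finset.range n, σ.rest^[k] (N (t - 1 - k)) = n
  sum_pick : ∀ t : ℤ, ∑ k ∈ Finset.range n, σ.pick (σ.rest^[k] (N (t - 1 - k))) = N t

theorem IsRecurrent.exists_pileHistory {σ : WellBehavedRule} {n : ℕ} {lam : Nat.Partition n}
    (h : σ.IsRecurrent lam) :
    ∃ N : ℤ → ℕ, σ.IsPileHistory n N ∧
      lam.parts = ((Multiset.range n).map fun k : ℕ =>
        σ.rest^[k] (N (-1 - k))).filter (· ≠ 0) := by
  obtain ⟨K, hK, hlam⟩ := h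
  have hKz : (0 : ℤ) < K := by exact_mod_cast hK
  -- the orbit of `lam`, extended periodically to all integer times
  set L : ℤ → Nat.Partition n := fun t => σ.move^[(t % K).toNat] lam with hLdef
  have hmod : ∀ m : ℕ, σ.move^[m % K] lam = σ.move^[m] lam := fun m =>
    Function.IsPeriodicPt.iterate_mod_apply (f := σ.move) hlam m
  have hL : ∀ t, L (t + 1) = σ.move (L t) := by
    intro t
    simp only [hLdef]
    rw [← Function.iterate_succ_apply' σ.move, ← hmod (Nat.succ _)]
    congr 2
    have h0 := Int.emod_nonneg t hKz.ne'
    have h1 : (((t + 1) % K).toNat : ℤ) = (((t % K).toNat.succ % K : ℕ) : ℤ) := by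
      rw [Int.toNat_of_nonneg (Int.emod_nonneg _ hKz.ne')]
      push_cast
      rw [Int.toNat_of_nonneg h0]
      simp
    exact_mod_cast h1
  have hparts : ∀ t : ℤ, (L t).parts = ((Multiset.range n).map fun k : ℕ =>
      σ.rest^[k] (((L (t - 1 - k)).parts.map σ.pick).sum)).filter (· ≠ 0) := by
    intro t
    have h1 := σ.parts_orbit L hL (t - n) n
    rw [sub_add_cancel] at h1
    rw [h1, Multiset.filter_add]
    have h2 : ((L (t - n)).parts.map (σ.rest^[n])).filter (· ≠ 0) = 0 := by
      rw [Multiset.filter_eq_nil]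
      intro a ha
      obtain ⟨b, hb, rfl⟩ := Multiset.mem_map.1 ha
      rw [not_not]
      exact σ.iterate_rest_eq_zero ((L (t - n)).le_of_mem_parts hb)
    rw [h2, add_zero]
  refine ⟨fun t => ((L t).parts.map σ.pick).sum, ⟨⟨K, hK, fun t => ?_⟩, fun t => ?_, fun t => ?_⟩,
    ?_⟩
  · simp only [hLdef, Int.add_emod_right]
  · have h1 := (L t).parts_sum
    rw [hparts t] at h1
    have h2 := sum_map_filter_ne_zero (f := id) rfl ((Multiset.range n).map fun k : ℕ =>
      σ.rest^[k] (((L (t - 1 - k)).parts.map σ.pick).sum))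
    rw [Multiset.map_id, Multiset.map_id, h1] at h2
    exact h2.symm
  · have h2 := sum_map_filter_ne_zero σ.pick_zero ((Multiset.range n).map fun k : ℕ =>
      σ.rest^[k] (((L (t - 1 - k)).parts.map σ.pick).sum))
    rw [← hparts t, Multiset.map_map] at h2
    exact h2.symm
  · have h1 := hparts 0
    have h2 : L 0 = lam := by simp [hLdef]
    rw [h2] at h1
    simpa using h1

end WellBehavedRule

/-! ### Counting piles -/

theorem le_getD_iff_lt_countP {l : List ℕ} (hl : l.Pairwise (· ≥ ·)) {h : ℕ} (hh : h ≠ 0) (i : ℕ) :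
    h ≤ l.getD i 0 ↔ i < l.countP (h ≤ ·) := by
  induction l generalizing i with
  | nil => simp [hh]
  | cons a l ih =>
    rw [List.pairwise_cons] at hl
    by_cases ha : h ≤ a
    · rw [List.countP_cons_of_pos (by simpa using ha)]
      cases i with
      | zero => simp [ha]
      | succ i => simpa using ih hl.2 i
    · have h0 : l.countP (h ≤ ·) = 0 := by
        rw [List.countP_eq_zero]
        intro b hb
        have := hl.1 b hb
        simp only [decide_eq_true_eq]
        omega
      rw [List.countP_cons_of_neg (by simpa using ha), h0]
      cases i with
      | zero => simp [ha]
      | succ i => simpa [h0] using ih hl.2 i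

theorem le_pile_iff {n : ℕ} (lam : Nat.Partition n) {h : ℕ} (hh : h ≠ 0) (i : ℕ) :
    h ≤ pile lam i ↔ i < lam.parts.countP (h ≤ ·) := by
  have h2 : lam.parts.countP (h ≤ ·) = (lam.parts.sort (· ≥ ·)).countP (h ≤ ·) := by
    conv_lhs => rw [← Multiset.sort_eq lam.parts (· ≥ ·)]
    rw [Multiset.coe_countP]
  rw [h2]
  exact le_getD_iff_lt_countP (Multiset.pairwise_sort lam.parts (· ≥ ·)) hh i

theorem countP_parts_eq_card {n : ℕ} {lam : Nat.Partition n} {f : ℕ → ℕ} {m : ℕ}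
    (hf : lam.parts = ((Multiset.range m).map f).filter (· ≠ 0)) {h : ℕ} (hh : h ≠ 0) :
    lam.parts.countP (h ≤ ·) = ((Finset.range m).filter fun k => h ≤ f k).card := by
  rw [hf, Multiset.countP_filter, Multiset.countP_map]
  change _ = Multiset.card (Multiset.filter _ (Multiset.range m))
  congr 1
  refine Multiset.filter_congr fun k _ => ?_
  constructor
  · exact fun h => h.1
  · exact fun h1 => ⟨h1, by omega⟩

/-- If the piles, in some order, lie above a decreasing sequence, so do the sorted piles. -/
theorem le_pile_of_parts_eq {n : ℕ} {lam : Nat.Partition n} {f a : ℕ → ℕ} {m : ℕ}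
    (hf : lam.parts = ((Multiset.range m).map f).filter (· ≠ 0)) (ha : Antitone a)
    (haf : ∀ k, a k ≤ f k) (ham : a m = 0) (i : ℕ) : a i ≤ pile lam i := by
  rcases eq_or_ne (a i) 0 with h0 | h0
  · omega
  rw [le_pile_iff lam h0, countP_parts_eq_card hf h0, Nat.lt_iff_add_one_le,
    ← Finset.card_range (i + 1)]
  refine Finset.card_le_card fun k hk => ?_
  have hki : k ≤ i := Nat.lt_succ_iff.1 (Finset.mem_range.1 hk)
  have him : i < m := by
    by_contra hmi
    have := ha (not_lt.1 hmi)
    omega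
  exact Finset.mem_filter.2 ⟨Finset.mem_range.2 (hki.trans_lt him), (ha hki).trans (haf k)⟩

/-- If the piles, in some order, lie below a decreasing sequence, so do the sorted piles. -/
theorem pile_le_of_parts_eq {n : ℕ} {lam : Nat.Partition n} {f b : ℕ → ℕ} {m : ℕ}
    (hf : lam.parts = ((Multiset.range m).map f).filter (· ≠ 0)) (hb : Antitone b)
    (hfb : ∀ k, f k ≤ b k) (i : ℕ) : pile lam i ≤ b i := by
  by_contra hcon
  have h1 : b i + 1 ≤ pile lam i := by omega
  rw [le_pile_iff lam (Nat.succ_ne_zero _), countP_parts_eq_card hf (Nat.succ_ne_zero _)] at h1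
  refine absurd h1 (not_lt.2 ?_)
  conv_rhs => rw [← Finset.card_range i]
  refine Finset.card_le_card fun k hk => ?_
  rw [Finset.mem_filter] at hk
  rw [Finset.mem_range]
  by_contra hki
  have h2 := hb (not_lt.1 hki)
  have h3 := hfb k
  omega

/-! ### Sizes of stable configurations -/

namespace WellBehavedRule

variable (σ : WellBehavedRule)

/-- The number of cards in the stable configuration with largest pile `h`. -/
def stableSize (h : ℕ) : ℕ := ∑ k ∈ Finset.range h, σ.rest^[k] h

theorem exists_isStable_stableSize (h : ℕ) :
    ∃ lam : Nat.Partition (σ.stableSize h), σ.IsStable lam := by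
  set M : Multiset ℕ := (Multiset.range h).map fun k => σ.rest^[k] h with hM
  have hsum : (M.map σ.pick).sum = h := by
    have h1 : ∀ m, ∑ k ∈ Finset.range m, σ.pick (σ.rest^[k] h) + σ.rest^[m] h = h := by
      intro m
      induction m with
      | zero => simp
      | succ m ih =>
        rw [Finset.sum_range_succ, Function.iterate_succ_apply']
        have := σ.rest_add_pick (σ.rest^[m] h)
        omega
    have h2 := h1 h
    rw [σ.iterate_rest_eq_zero le_rfl, add_zero] at h2
    rw [hM, Multiset.map_map]
    exact h2
  refine ⟨Nat.Partition.ofSums _ M rfl, Nat.Partition.ext ?_⟩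
  rw [σ.parts_move_of_parts_eq (M := M) rfl, hsum]
  change _ = M.filter (· ≠ 0)
  have h3 : h ::ₘ M.map σ.rest = (Multiset.range (h + 1)).map fun k => σ.rest^[k] h := by
    rw [map_range_succ_eq_cons, hM, Multiset.map_map]
    congr 1
    refine Multiset.map_congr rfl fun k _ => ?_
    rw [Function.comp_apply, ← Function.iterate_succ_apply' σ.rest]
  rw [h3, Multiset.range_succ, Multiset.map_cons, σ.iterate_rest_eq_zero le_rfl,
    Multiset.filter_cons_of_neg _ (by simp)]

theorem le_stableSize (h : ℕ) : h ≤ σ.stableSize h := by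
  cases h with
  | zero => simp
  | succ h =>
    exact Finset.single_le_sum (f := fun k => σ.rest^[k] (h + 1)) (fun _ _ => Nat.zero_le _)
      (Finset.mem_range.2 h.succ_pos)

theorem stableSize_succ_le (h : ℕ) : σ.stableSize (h + 1) ≤ 2 * σ.stableSize h + 1 := by
  have h1 : σ.stableSize (h + 1) ≤ ∑ k ∈ Finset.range (h + 1), (σ.rest^[k] h + 1) :=
    Finset.sum_le_sum fun k _ => σ.iterate_rest_add_one_le k h
  rw [Finset.sum_add_distrib, Finset.sum_range_succ, σ.iterate_rest_eq_zero le_rfl] at h1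
  simp only [Finset.sum_const, Finset.card_range, smul_eq_mul, mul_one, add_zero] at h1
  have h2 := σ.le_stableSize h
  unfold stableSize at *
  omega

theorem nStar_le (n : ℕ) : σ.nStar n ≤ n := by
  classical
  exact Nat.findGreatest_le n

theorem le_two_mul_nStar_add_one (n : ℕ) : n ≤ 2 * σ.nStar n + 1 := by
  classical
  have hex : ∃ h, n < σ.stableSize h := ⟨n + 1, σ.le_stableSize (n + 1)⟩
  obtain ⟨h, hh⟩ : ∃ h, Nat.find hex = h + 1 := by
    refine Nat.exists_eq_succ_of_ne_zero fun h0 => ?_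
    have h1 := Nat.find_spec hex
    rw [h0] at h1
    simp [stableSize] at h1
  have h1 := Nat.find_spec hex
  rw [hh] at h1
  have h2 : σ.stableSize h ≤ n := not_lt.1 (Nat.find_min hex (by omega))
  have h3 : σ.stableSize h ≤ σ.nStar n :=
    Nat.le_findGreatest (P := fun m => ∃ lam : Nat.Partition m, σ.IsStable lam) h2
      (σ.exists_isStable_stableSize h)
  have h4 := σ.stableSize_succ_le h
  omega

theorem IsStable.isRecurrent {σ : WellBehavedRule} {n : ℕ} {lam : Nat.Partition n}
    (h : σ.IsStable lam) : σ.IsRecurrent lam := ⟨1, one_pos, h⟩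

end WellBehavedRule

/-! ### Periodic pile histories -/

/-- The number of piles alive grows by at most one per step, namely by the new pile. -/
theorem card_alive_succ_le (P : ℕ → ℤ → Prop) [∀ k, DecidablePred (P k)]
    (hP : ∀ k s, P (k + 1) s → P k s) (n : ℕ) (t : ℤ) :
    ((Finset.range n).filter fun k : ℕ => P k (t + 1 - 1 - k)).card ≤
      ((Finset.range n).filter fun k : ℕ => P k (t - 1 - k)).card + 1 := by
  have hsub : ((Finset.range n).filter fun k : ℕ => P k (t + 1 - 1 - k)) ⊆
      insert 0 (((Finset.range n).filter fun k : ℕ => P k (t - 1 - k)).image Nat.succ) := by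
    intro k hk
    rw [Finset.mem_filter, Finset.mem_range] at hk
    rw [Finset.mem_insert]
    cases k with
    | zero => exact Or.inl rfl
    | succ k =>
      refine Or.inr (Finset.mem_image_of_mem _ (Finset.mem_filter.2 ⟨?_, hP k _ ?_⟩))
      · exact Finset.mem_range.2 (by omega)
      · convert hk.2 using 1
        push_cast
        ring
  exact (Finset.card_le_card hsub).trans
    ((Finset.card_insert_le _ _).trans (Nat.add_le_add_right Finset.card_image_le 1))

/-- A property of times that is `K`-periodic and passes from `t` to `t - d` holds along the whole
progression of step `d`. -/
theorem forall_add_mul_of_periodic {S : ℤ → Prop} {K : ℕ} (hK : 0 < K)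
    (hS : ∀ t, S (t + K) ↔ S t) {d : ℤ} (hd : ∀ t, S t → S (t - d)) {t : ℤ} (ht : S t) (a : ℤ) :
    S (t + a * d) := by
  have h1 : ∀ (j : ℕ) (s : ℤ), S s → S (s - j * d) := by
    intro j
    induction j with
    | zero => intro s hs; simpa using hs
    | succ j ih =>
      intro s hs
      have := hd _ (ih s hs)
      convert this using 1
      push_cast
      ring
  have h2 : ∀ (j : ℕ) (s : ℤ), S (s + j * K) ↔ S s := by
    intro j
    induction j with
    | zero => intro s; simp
    | succ j ih =>
      intro s
      rw [← ih s, ← hS (s + j * K)]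
      congr! 1
      push_cast
      ring
  have h3 : ∀ (a s : ℤ), S (s + a * K) ↔ S s := by
    intro a s
    obtain ⟨j, rfl | rfl⟩ := a.eq_nat_or_neg
    · exact h2 j s
    · rw [← h2 j]
      congr! 1
      ring
  obtain ⟨j, rfl | rfl⟩ := a.eq_nat_or_neg
  · -- going forward `j` steps is going backward `j * (K - 1)` steps, up to a period
    have h4 := h1 (j * (K - 1)) t ht
    rw [← h3 (j * d)] at h4
    convert h4 using 1
    rw [Nat.cast_mul, Nat.cast_sub hK]
    push_cast
    ring
  · convert h1 j t ht using 1
    ring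

/-- In a periodic history of ordinary Bulgarian solitaire, where each pile loses one card per move,
the new piles take at most two consecutive sizes: the times at which the maximal size `M` is
attained are invariant under shifts by `M`, those of the minimal size `m` under shifts by `m + 1`,
so some maximal time comes less than `gcd M (m + 1)` steps after some minimal one, while the size
grows by at most one per step. -/
theorem exists_forall_mem_Icc_of_bulgarian {n : ℕ} {N : ℤ → ℕ}
    (hper : ∃ K : ℕ, 0 < K ∧ ∀ t, N (t + K) = N t) (hle : ∀ t, N t ≤ n)
    (hN : ∀ t : ℤ, N t = ((Finset.range n).filter fun k : ℕ => k < N (t - 1 - k)).card) :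
    ∃ m, ∀ t, m ≤ N t ∧ N t ≤ m + 1 := by
  obtain ⟨K, hK, hper⟩ := hper
  obtain ⟨t₁, ht₁⟩ : ∃ t₁, ∀ t, N t₁ ≤ N t := ⟨Function.argmin N, fun t => Function.argmin_le N t⟩
  obtain ⟨t₀, ht₀⟩ : ∃ t₀, ∀ t, N t ≤ N t₀ := by
    refine ⟨Function.argmin fun t => n - N t, fun t => ?_⟩
    have h1 := Function.argmin_le (fun t => n - N t) t
    have h2 := hle t
    have h3 := hle (Function.argmin fun t => n - N t)
    omega
  set m := N t₁ with hm
  set M := N t₀ with hM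
  refine ⟨m, fun t => ⟨ht₁ t, (ht₀ t).trans ?_⟩⟩
  have hstep : ∀ t, N (t + 1) ≤ N t + 1 := by
    intro t
    rw [hN (t + 1), hN t]
    exact card_alive_succ_le (fun k s => k < N s) (fun k s h => by omega) n t
  have hmax : ∀ t, N t = M → N (t - M) = M := by
    intro t ht
    refine le_antisymm (ht₀ _) ?_
    rcases Nat.eq_zero_or_pos M with h0 | hpos
    · omega
    have hsub : ((Finset.range n).filter fun k : ℕ => k < N (t - 1 - k)) ⊆ Finset.range M :=
      fun k hk => Finset.mem_range.2 ((Finset.mem_filter.1 hk).2.trans_le (ht₀ _))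
    have heq := Finset.eq_of_subset_of_card_le hsub (by rw [← hN t, ht, Finset.card_range])
    have hmem : M - 1 ∈ Finset.range M := Finset.mem_range.2 (by omega)
    rw [← heq, Finset.mem_filter] at hmem
    have h1 : t - 1 - ((M - 1 : ℕ) : ℤ) = t - M := by
      rw [Nat.cast_sub hpos]
      push_cast
      ring
    rw [h1] at hmem
    omega
  have hmin : ∀ t, N t = m → N (t - (m + 1 : ℕ)) = m := by
    intro t ht
    refine le_antisymm ?_ (ht₁ _)
    by_contra hcon
    have h1 : t - ((m + 1 : ℕ) : ℤ) = t - 1 - (m : ℕ) := by push_cast; ring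
    rw [h1] at hcon
    have hsub : Finset.range (m + 1) ⊆ (Finset.range n).filter fun k : ℕ => k < N (t - 1 - k) := by
      intro k hk
      rw [Finset.mem_range] at hk
      have h2 := hle (t - 1 - (m : ℕ))
      refine Finset.mem_filter.2 ⟨Finset.mem_range.2 (by omega), ?_⟩
      rcases Nat.lt_succ_iff_lt_or_eq.1 hk with h | rfl
      · exact h.trans_le (ht₁ _)
      · omega
    have h3 := Finset.card_le_card hsub
    rw [← hN t, ht, Finset.card_range] at h3
    omega
  have hgrow : ∀ (j : ℕ) (t : ℤ), N (t + j) ≤ N t + j := by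
    intro j
    induction j with
    | zero => simp
    | succ j ih =>
      intro t
      have h1 := hstep (t + j)
      have h2 := ih t
      have h3 : t + ((j + 1 : ℕ) : ℤ) = t + j + 1 := by push_cast; ring
      rw [h3]
      omega
  set g := Int.gcd (M : ℤ) ((m + 1 : ℕ) : ℤ) with hg
  have hgpos : (0 : ℤ) < g := by
    have : g ≠ 0 := by
      rw [hg, Ne, Int.gcd_eq_zero_iff]
      omega
    omega
  set u := Int.gcdA (M : ℤ) ((m + 1 : ℕ) : ℤ)
  set v := Int.gcdB (M : ℤ) ((m + 1 : ℕ) : ℤ)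
  have hbez : (g : ℤ) = M * u + (m + 1 : ℕ) * v := Int.gcd_eq_gcd_ab _ _
  set c := (t₀ - t₁) / g
  have hdiv : g * c + (t₀ - t₁) % g = t₀ - t₁ := Int.mul_ediv_add_emod _ _
  have hd0 := Int.emod_nonneg (t₀ - t₁) hgpos.ne'
  have hdlt := Int.emod_lt_of_pos (t₀ - t₁) hgpos
  have hT : N (t₀ + (-(c * u)) * M) = M :=
    forall_add_mul_of_periodic (S := fun t => N t = M) hK (fun t => by rw [hper]) hmax rfl _
  have hU : N (t₁ + c * v * (m + 1 : ℕ)) = m :=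
    forall_add_mul_of_periodic (S := fun t => N t = m) hK (fun t => by rw [hper]) hmin rfl _
  obtain ⟨d, hd⟩ := Int.eq_ofNat_of_zero_le hd0
  have hTU : t₀ + (-(c * u)) * M = t₁ + c * v * (m + 1 : ℕ) + d := by
    have h1 := congrArg (· * c) hbez
    have h2 : (d : ℤ) = t₀ - t₁ - g * c := by linarith
    rw [h2, h1]
    ring
  have hMd : M ≤ m + d := by
    have h1 := hgrow d (t₁ + c * v * (m + 1 : ℕ))
    rwa [← hTU, hT, hU] at h1
  -- now `M - m ≤ d < g`, while `g` divides `M - (m + 1)`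
  by_contra hcon
  have hgdvd : (g : ℤ) ∣ (M : ℤ) - (m + 1 : ℕ) :=
    dvd_sub (Int.gcd_dvd_left _ _) (Int.gcd_dvd_right _ _)
  have h5 := Int.le_of_dvd (by omega) hgdvd
  omega

namespace WellBehavedRule.IsPileHistory

variable {σ : WellBehavedRule} {n : ℕ} {N : ℤ → ℕ}

theorem le (hN : σ.IsPileHistory n N) (t : ℤ) : N t ≤ n := by
  rcases Nat.eq_zero_or_pos n with rfl | hn
  · have := hN.sum_pick t
    simp at this
    omega
  · have h1 := hN.sum_rest (t + 1)
    have h2 := Finset.single_le_sum (f := fun k : ℕ => σ.rest^[k] (N (t + 1 - 1 - k)))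
      (fun _ _ => Nat.zero_le _) (Finset.mem_range.2 hn)
    rw [h1] at h2
    simpa using h2

/-- The number of piles at time `t`; the age of a pile is always less than `n`. -/
def numPiles (_hN : σ.IsPileHistory n N) (t : ℤ) : ℕ :=
  ((Finset.range n).filter fun k : ℕ => σ.rest^[k] (N (t - 1 - k)) ≠ 0).card

theorem numPiles_succ_le (hN : σ.IsPileHistory n N) (t : ℤ) :
    hN.numPiles (t + 1) ≤ hN.numPiles t + 1 := by
  refine card_alive_succ_le (fun k s => σ.rest^[k] (N s) ≠ 0) (fun k s h h0 => h ?_) n t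
  rw [Function.iterate_succ_apply', h0, σ.rest_zero]

theorem numPiles_le_sub_add (hN : σ.IsPileHistory n N) (t : ℤ) (j : ℕ) :
    hN.numPiles t ≤ hN.numPiles (t - j) + j := by
  induction j with
  | zero => simp
  | succ j ih =>
    have h1 := hN.numPiles_succ_le (t - (j + 1 : ℕ))
    have h2 : t - ((j + 1 : ℕ) : ℤ) + 1 = t - j := by push_cast; ring
    rw [h2] at h1
    omega

theorem numPiles_le (hN : σ.IsPileHistory n N) (t : ℤ) : hN.numPiles t ≤ N t := by
  rw [← hN.sum_pick t, numPiles, Finset.card_filter]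
  refine Finset.sum_le_sum fun k _ => ?_
  split_ifs with h
  · exact σ.one_le_pick h
  · exact Nat.zero_le _

end WellBehavedRule.IsPileHistory

/-! ### The proportional rule -/

section Proportion

variable {q : ℝ} (hq : q ∈ Set.Ioc (0 : ℝ) 1)

theorem le_proportionRule_pick (h : ℕ) : q * h ≤ (proportionRule q hq).pick h := Nat.le_ceil _

theorem proportionRule_pick_le (h : ℕ) :
    ((proportionRule q hq).pick h : ℝ) ≤ q * h + if h ≠ 0 then 1 else 0 := by
  split_ifs with h0
  · exact (Nat.ceil_lt_add_one (mul_nonneg hq.1.le h.cast_nonneg)).le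
  · rw [not_not] at h0
    subst h0
    simp [WellBehavedRule.pick_zero]

theorem proportionRule_rest_eq (h : ℕ) :
    ((proportionRule q hq).rest h : ℝ) = h - (proportionRule q hq).pick h :=
  eq_sub_of_add_eq (by exact_mod_cast (proportionRule q hq).rest_add_pick h)

theorem proportionRule_iterate_rest_le (k h : ℕ) :
    ((proportionRule q hq).rest^[k] h : ℝ) ≤ (1 - q) ^ k * h := by
  induction k with
  | zero => simp
  | succ k ih =>
    rw [Function.iterate_succ_apply', proportionRule_rest_eq, pow_succ]
    have h1 := le_proportionRule_pick hq ((proportionRule q hq).rest^[k] h)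
    have h2 := mul_le_mul_of_nonneg_left ih (sub_nonneg.2 hq.2)
    linarith

/-- Rounding costs at most one card per move, hence at most `∑ (1 - q) ^ j = 1 / q` cards
altogether. -/
theorem le_proportionRule_iterate_rest (k h : ℕ) :
    (1 - q) ^ k * (q * h) - 1 ≤ q * (proportionRule q hq).rest^[k] h := by
  induction k with
  | zero => simp
  | succ k ih =>
    rw [Function.iterate_succ_apply', proportionRule_rest_eq, pow_succ]
    set r := (proportionRule q hq).rest^[k] h
    have h1 : ((proportionRule q hq).pick r : ℝ) ≤ q * r + 1 :=
      (proportionRule_pick_le hq r).trans (by split_ifs <;> simp)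
    have h2 := mul_le_mul_of_nonneg_left ih (sub_nonneg.2 hq.2)
    have h3 := mul_le_mul_of_nonneg_left h1 hq.1.le
    linarith

theorem proportionRule_pick_eq_one {h : ℕ} (h0 : h ≠ 0) (hh : q * h ≤ 1) :
    (proportionRule q hq).pick h = 1 :=
  le_antisymm (Nat.ceil_le.2 (by simpa using hh)) ((proportionRule q hq).one_le_pick h0)

/-- Piles of at most `1 / q` cards lose one card per move. -/
theorem proportionRule_iterate_rest_eq_sub {h : ℕ} (hh : q * h ≤ 1) (k : ℕ) :
    (proportionRule q hq).rest^[k] h = h - k := by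
  induction k with
  | zero => simp
  | succ k ih =>
    rw [Function.iterate_succ_apply', ih]
    rcases eq_or_ne (h - k) 0 with h0 | h0
    · rw [h0, WellBehavedRule.rest_zero]
      omega
    · have h1 : q * ((h - k : ℕ) : ℝ) ≤ 1 := by
        refine le_trans (mul_le_mul_of_nonneg_left ?_ hq.1.le) hh
        exact_mod_cast Nat.sub_le h k
      rw [WellBehavedRule.rest, proportionRule_pick_eq_one hq h0 h1]
      omega

/-- A pile that survives `k` moves has more than `k - j` cards after `j` of them, and loses at
least the proportion `q` of these at the next one. -/
theorem mul_le_of_proportionRule_iterate_rest_ne_zero (k : ℕ) {h : ℕ}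
    (hh : (proportionRule q hq).rest^[k] h ≠ 0) : q * (k * (k + 1)) ≤ 2 * h := by
  induction k generalizing h with
  | zero => simp
  | succ k ih =>
    have h1 : k + 1 ≤ h := by
      have := (proportionRule q hq).iterate_rest_le_sub (k + 1) h
      omega
    rw [Function.iterate_succ_apply] at hh
    have h2 := ih hh
    rw [proportionRule_rest_eq] at h2
    have h3 := le_proportionRule_pick hq h
    have h4 : q * ((k + 1 : ℕ) : ℝ) ≤ q * h :=
      mul_le_mul_of_nonneg_left (by exact_mod_cast h1) hq.1.le
    push_cast at h4 ⊢
    nlinarith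

variable {n : ℕ} {N : ℤ → ℕ}

theorem le_pileHistory (hN : (proportionRule q hq).IsPileHistory n N) (t : ℤ) : q * n ≤ N t := by
  rw [← hN.sum_pick t]
  conv_lhs => rw [← hN.sum_rest t]
  push_cast
  rw [Finset.mul_sum]
  exact Finset.sum_le_sum fun k _ => le_proportionRule_pick hq _

theorem pileHistory_le (hN : (proportionRule q hq).IsPileHistory n N) (t : ℤ) :
    (N t : ℝ) ≤ q * n + hN.numPiles t := by
  have hn : (n : ℝ) = ((∑ k ∈ Finset.range n, (proportionRule q hq).rest^[k] (N (t - 1 - k)) : ℕ) :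
      ℝ) := by rw [hN.sum_rest t]
  conv_lhs => rw [← hN.sum_pick t]
  rw [WellBehavedRule.IsPileHistory.numPiles, Finset.card_filter, hn]
  push_cast
  rw [Finset.mul_sum, ← Finset.sum_add_distrib]
  exact Finset.sum_le_sum fun k _ => proportionRule_pick_le hq _

/-- A pile of `H` cards lives for about `√(2 H / q)` moves at most. Applied to the largest pile this
bounds the number of piles, and thereby the largest pile itself. -/
theorem mul_pileHistory_le (hN : (proportionRule q hq).IsPileHistory n N) (t : ℤ) :
    q * N t ≤ q ^ 2 * n + √(4 * (q ^ 2 * n) + 8) + 1 := by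
  obtain ⟨t₀, ht₀⟩ : ∃ t₀, ∀ t, N t ≤ N t₀ := by
    refine ⟨Function.argmin fun t => n - N t, fun t => ?_⟩
    have h1 := Function.argmin_le (fun t => n - N t) t
    have h2 := hN.le t
    have h3 := hN.le (Function.argmin fun t => n - N t)
    omega
  have hq0 := hq.1
  set x : ℝ := q * N t₀ with hx
  have hx0 : 0 ≤ x := by positivity
  have hpiles : q * hN.numPiles t₀ ≤ √(2 * x) + 1 := by
    have hsub : ((Finset.range n).filter fun k : ℕ =>
        (proportionRule q hq).rest^[k] (N (t₀ - 1 - k)) ≠ 0) ⊆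
          Finset.range (⌊√(2 * x) / q⌋₊ + 1) := by
      intro k hk
      have h1 := mul_le_of_proportionRule_iterate_rest_ne_zero hq k (Finset.mem_filter.1 hk).2
      have h2 : ((N (t₀ - 1 - k) : ℕ) : ℝ) ≤ N t₀ := by exact_mod_cast ht₀ _
      rw [Finset.mem_range, Nat.lt_succ_iff]
      refine Nat.le_floor ?_
      rw [le_div_iff₀ hq0]
      refine Real.le_sqrt_of_sq_le ?_
      have h3 : q * (k * (k + 1)) ≤ 2 * N t₀ := by linarith
      have h4 := mul_le_mul_of_nonneg_left h3 hq0.le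
      have h5 : 0 ≤ q * q * k := by positivity
      rw [hx]
      nlinarith
    have h1 := Finset.card_le_card hsub
    rw [Finset.card_range] at h1
    have h2 : (hN.numPiles t₀ : ℝ) ≤ ⌊√(2 * x) / q⌋₊ + 1 := by exact_mod_cast h1
    have h3 : (⌊√(2 * x) / q⌋₊ : ℝ) ≤ √(2 * x) / q := Nat.floor_le (by positivity)
    calc q * hN.numPiles t₀ ≤ q * (√(2 * x) / q + 1) :=
          mul_le_mul_of_nonneg_left (h2.trans (by linarith)) hq0.le
      _ = √(2 * x) + q := by field_simp
      _ ≤ √(2 * x) + 1 := by linarith [hq.2]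
  have h1 : x ≤ q ^ 2 * n + √(2 * x) + 1 := by
    have := mul_le_mul_of_nonneg_left (pileHistory_le hq hN t₀) hq0.le
    nlinarith
  -- since `√(2 x) ≤ x / 2 + 1`, a first crude bound is `x ≤ 2 q² n + 4`
  have h2 : √(2 * x) ≤ x / 2 + 1 := by
    rw [Real.sqrt_le_left (by linarith)]
    nlinarith [sq_nonneg (x / 2 - 1)]
  have h3 : √(2 * x) ≤ √(4 * (q ^ 2 * n) + 8) := Real.sqrt_le_sqrt (by linarith)
  have h4 : q * N t ≤ x := mul_le_mul_of_nonneg_left (by exact_mod_cast ht₀ t) hq0.le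
  linarith

theorem sum_range_odd_reflect (j : ℕ) :
    ∑ k ∈ Finset.range j, (2 * (j - 1 - k) + 1) = j * j := by
  rw [Finset.sum_range_reflect (fun k => 2 * k + 1)]
  induction j with
  | zero => simp
  | succ j ih =>
    rw [Finset.sum_range_succ, ih]
    ring

/-- If there are `ℓ` piles now, then the pile made `k` moves ago had at least about `ℓ - k` cards,
as the number of piles grows by at most one per move. Cut down to `1 / q` cards, it would lose one
card per move, so it still has at least about `min ℓ (1 / q) - 2 k` of them; summing over `k` gives
the bound. -/
theorem sq_half_numPiles_le (hN : (proportionRule q hq).IsPileHistory n N) (t : ℤ) :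
    (min (hN.numPiles t) ⌊1 / q⌋₊ / 2) * (min (hN.numPiles t) ⌊1 / q⌋₊ / 2) ≤ n := by
  set D := ⌊1 / q⌋₊ with hD
  set j := min (hN.numPiles t) D / 2 with hj
  have hjn : j ≤ n := by
    have h1 : hN.numPiles t ≤ n := (hN.numPiles_le t).trans (hN.le t)
    omega
  rw [← sum_range_odd_reflect j]
  conv_rhs => rw [← hN.sum_rest t]
  refine (Finset.sum_le_sum fun k hk => ?_).trans
    (Finset.sum_le_sum_of_subset (Finset.range_subset_range.2 hjn))
  rw [Finset.mem_range] at hk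
  set h := N (t - 1 - k) with hh
  have hmin : q * (min h D : ℕ) ≤ 1 := by
    have h1 : ((min h D : ℕ) : ℝ) ≤ 1 / q :=
      le_trans (by exact_mod_cast min_le_right h D)
        (Nat.floor_le (one_div_nonneg.2 hq.1.le))
    rw [le_div_iff₀ hq.1] at h1
    linarith
  have h1 := (proportionRule q hq).monotone_iterate_rest k (min_le_left h D)
  rw [proportionRule_iterate_rest_eq_sub hq hmin] at h1
  have h2 := hN.numPiles_le (t - 1 - k)
  have h3 := hN.numPiles_le_sub_add t (k + 1)
  have h4 : t - ((k + 1 : ℕ) : ℤ) = t - 1 - k := by push_cast; ring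
  rw [h4] at h3
  omega

/-- When `q ^ 2 * n` is small, no pile ever exceeds `1 / q`, so the game is ordinary Bulgarian
solitaire. -/
theorem mul_pileHistory_le_one (hN : (proportionRule q hq).IsPileHistory n N)
    (hqn : 100 * (q ^ 2 * n) ≤ 1) (t : ℤ) : q * N t ≤ 1 := by
  have hq0 := hq.1
  rcases Nat.eq_zero_or_pos n with h0 | hn
  · have h1 : N t = 0 := by have := hN.le t; omega
    simp [h1]
  have hn1 : (1 : ℝ) ≤ n := by exact_mod_cast hn
  have hq10 : q ≤ 1 / 10 := by
    refine le_of_abs_le (abs_le_of_sq_le_sq ?_ (by norm_num))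
    nlinarith [sq_nonneg q]
  have hsq := sq_half_numPiles_le hq hN t
  set D := ⌊1 / q⌋₊ with hD
  set j := min (hN.numPiles t) D / 2 with hj
  have hqj : q * j ≤ 1 / 10 := by
    refine le_of_abs_le (abs_le_of_sq_le_sq ?_ (by norm_num))
    have h1 : (j : ℝ) * j ≤ n := by exact_mod_cast hsq
    nlinarith [sq_nonneg q]
  -- otherwise `j` is half of `1 / q`, up to rounding, against `q * j ≤ 1 / 10`
  have hle : hN.numPiles t ≤ D := by
    by_contra hcon
    have h1 : D + 1 ≤ 2 * j + 2 := by omega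
    have h2 : 1 / q < D + 1 := Nat.lt_floor_add_one _
    have h3 : (D : ℝ) + 1 ≤ 2 * j + 2 := by exact_mod_cast h1
    rw [div_lt_iff₀ hq0] at h2
    nlinarith
  have h1 : hN.numPiles t ≤ 2 * j + 1 := by omega
  have h2 : (hN.numPiles t : ℝ) ≤ 2 * j + 1 := by exact_mod_cast h1
  have h3 := pileHistory_le hq hN t
  nlinarith

theorem two_mul_sum_range_sub_le (n m : ℕ) :
    2 * ∑ k ∈ Finset.range n, (m - k) ≤ m * (m + 1) := by
  induction n generalizing m with
  | zero => simp
  | succ n ih =>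
    rw [Finset.sum_range_succ']
    cases m with
    | zero => simp
    | succ m =>
      have h1 := ih m
      simp only [Nat.add_sub_add_right, Nat.sub_zero]
      nlinarith

theorem two_mul_sum_range_sub {n m : ℕ} (hmn : m ≤ n) :
    2 * ∑ k ∈ Finset.range n, (m - k) = m * (m + 1) := by
  induction n generalizing m with
  | zero =>
    obtain rfl : m = 0 := by omega
    simp
  | succ n ih =>
    rw [Finset.sum_range_succ']
    cases m with
    | zero => simp
    | succ m =>
      have h1 := ih (m := m) (by omega)
      simp only [Nat.add_sub_add_right, Nat.sub_zero]
      nlinarith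

/-- For small `q ^ 2 * n`, recurrent configurations are staircases up to one extra diagonal. -/
theorem exists_pile_bounds_of_small {lam : Nat.Partition n}
    (hlam : (proportionRule q hq).IsRecurrent lam) (hqn : 100 * (q ^ 2 * n) ≤ 1) :
    ∃ m : ℕ, m * (m + 1) ≤ 2 * n ∧ 2 * n ≤ (m + 1) * (m + 2) ∧
      ∀ i, m - i ≤ pile lam i ∧ pile lam i ≤ m + 1 - i := by
  obtain ⟨N, hN, hparts⟩ := hlam.exists_pileHistory
  have hrest : ∀ (k : ℕ) (t : ℤ), (proportionRule q hq).rest^[k] (N t) = N t - k := fun k t =>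
    proportionRule_iterate_rest_eq_sub hq (mul_pileHistory_le_one hq hN hqn t) k
  obtain ⟨m, hm⟩ : ∃ m, ∀ t, m ≤ N t ∧ N t ≤ m + 1 := by
    refine exists_forall_mem_Icc_of_bulgarian hN.periodic hN.le fun t => ?_
    conv_lhs => rw [← hN.sum_pick t]
    rw [Finset.card_filter]
    refine Finset.sum_congr rfl fun k _ => ?_
    rw [hrest]
    split_ifs with h
    · refine proportionRule_pick_eq_one hq (by omega) ?_
      rw [← hrest]
      refine le_trans (mul_le_mul_of_nonneg_left ?_ hq.1.le)
        (mul_pileHistory_le_one hq hN hqn (t - 1 - k))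
      rw [hrest]
      exact_mod_cast Nat.sub_le _ _
    · rw [Nat.sub_eq_zero_of_le (not_lt.1 h), WellBehavedRule.pick_zero]
  have hsum := hN.sum_rest 0
  simp only [hrest] at hsum
  refine ⟨m, ?_, ?_, fun i => ⟨?_, ?_⟩⟩
  · rw [← two_mul_sum_range_sub ((hm 0).1.trans (hN.le 0))]
    conv_rhs => rw [← hsum]
    exact Nat.mul_le_mul_left 2 (Finset.sum_le_sum fun k _ => Nat.sub_le_sub_right (hm _).1 k)
  · refine le_trans ?_ (two_mul_sum_range_sub_le n (m + 1))
    conv_lhs => rw [← hsum]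
    exact Nat.mul_le_mul_left 2 (Finset.sum_le_sum fun k _ => Nat.sub_le_sub_right (hm _).2 k)
  · refine le_pile_of_parts_eq (a := fun i => m - i) hparts (fun i j hij => by simp; omega)
      (fun k => ?_) ?_ i
    · rw [hrest]
      exact Nat.sub_le_sub_right (hm _).1 k
    · have := (hm 0).1.trans (hN.le 0)
      omega
  · refine pile_le_of_parts_eq (b := fun i => m + 1 - i) hparts (fun i j hij => by simp; omega)
      (fun k => ?_) i
    rw [hrest]
    exact Nat.sub_le_sub_right (hm _).2 k

/-- In general, the piles of a recurrent configuration decay geometrically, up to errors that are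
negligible when `q ^ 2 * n` is large. -/
theorem mul_pile_bounds {lam : Nat.Partition n}
    (hlam : (proportionRule q hq).IsRecurrent lam) (i : ℕ) :
    (1 - q) ^ i * (q ^ 2 * n) - 1 ≤ q * pile lam i ∧
      q * pile lam i ≤ (1 - q) ^ i * (q ^ 2 * n + √(4 * (q ^ 2 * n) + 8) + 1) ∧
      q ^ 2 * n ≤ q * pile lam 0 := by
  obtain ⟨N, hN, hparts⟩ := hlam.exists_pileHistory
  have hq0 := hq.1
  have hpow : 0 ≤ (1 - q) ^ i := pow_nonneg (sub_nonneg.2 hq.2) i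
  set lo := N (Function.argmin N) with hlo
  have hlow : ∀ i, (proportionRule q hq).rest^[i] lo ≤ pile lam i :=
    le_pile_of_parts_eq hparts ((proportionRule q hq).antitone_iterate_rest lo)
      (fun k => (proportionRule q hq).monotone_iterate_rest k (Function.argmin_le N _))
      ((proportionRule q hq).iterate_rest_eq_zero (hN.le _))
  have hqlo : q ^ 2 * n ≤ q * lo := by
    have := mul_le_mul_of_nonneg_left (le_pileHistory hq hN (Function.argmin N)) hq0.le
    rw [← hlo] at this
    linarith
  refine ⟨?_, ?_, ?_⟩
  · have h1 := le_proportionRule_iterate_rest hq i lo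
    have h2 : q * ((proportionRule q hq).rest^[i] lo : ℕ) ≤ q * pile lam i :=
      mul_le_mul_of_nonneg_left (by exact_mod_cast hlow i) hq0.le
    have h3 := mul_le_mul_of_nonneg_left hqlo hpow
    linarith
  · set A := q ^ 2 * n + √(4 * (q ^ 2 * n) + 8) + 1 with hA
    have hA0 : 0 ≤ A := by positivity
    set hi := ⌊A / q⌋₊
    have hhi : ∀ t, N t ≤ hi := fun t => Nat.le_floor <| by
      rw [le_div_iff₀ hq0, mul_comm]
      exact mul_pileHistory_le hq hN t
    have h1 : pile lam i ≤ (proportionRule q hq).rest^[i] hi :=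
      pile_le_of_parts_eq hparts ((proportionRule q hq).antitone_iterate_rest hi)
        (fun k => (proportionRule q hq).monotone_iterate_rest k (hhi _)) i
    have h2 : (pile lam i : ℝ) ≤ (1 - q) ^ i * hi :=
      le_trans (by exact_mod_cast h1) (proportionRule_iterate_rest_le hq i hi)
    have h3 : (hi : ℝ) ≤ A / q := Nat.floor_le (by positivity)
    rw [le_div_iff₀ hq0] at h3
    calc q * (pile lam i : ℝ) ≤ q * ((1 - q) ^ i * hi) := mul_le_mul_of_nonneg_left h2 hq0.le
      _ = (1 - q) ^ i * (hi * q) := by ring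
      _ ≤ (1 - q) ^ i * A := mul_le_mul_of_nonneg_left h3 hpow
  · refine hqlo.trans (mul_le_mul_of_nonneg_left ?_ hq0.le)
    exact_mod_cast hlow 0

end Proportion

/-! ### Limit shapes -/

/-- The index of the pile read off by the downscaled boundary function, up to rounding. -/
theorem exists_downscaled_eq {n : ℕ} (lam : Nat.Partition n) (x : ℝ≥0) :
    ∃ i : ℕ, (downscaled lam x : ℝ) = pile lam i / pile lam 0 ∧
      (i : ℝ) ≤ x * n / pile lam 0 ∧ x * n / pile lam 0 < (i : ℝ) + 1 := by
  refine ⟨⌊x * n / (pile lam 0 : ℝ≥0)⌋₊, ?_, ?_, ?_⟩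
  · simp [downscaled, boundary]
  · exact_mod_cast Nat.floor_le (zero_le (a := x * n / (pile lam 0 : ℝ≥0)))
  · exact_mod_cast Nat.lt_floor_add_one (x * n / (pile lam 0 : ℝ≥0))

/-- The triangular limit for recurrent configurations of `c n` cards. -/
theorem tendsto_downscaled_triangular {q : ℕ → ℝ} (hq : ∀ n, q n ∈ Set.Ioc (0 : ℝ) 1) {c : ℕ → ℕ}
    (hc : Tendsto c atTop atTop) (hqc : Tendsto (fun n => q n ^ 2 * (c n : ℝ)) atTop (𝓝 0))
    (lam : ∀ n, Nat.Partition (c n))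
    (hlam : ∀ n, 1 ≤ n → (proportionRule (q n) (hq n)).IsRecurrent (lam n)) (x : ℝ≥0) :
    Tendsto (fun n => downscaled (lam n) x) atTop (𝓝 (triangularShape x)) := by
  rw [← NNReal.tendsto_coe]
  change Tendsto _ _ (𝓝 (max (1 - (x : ℝ) / 2) 0))
  choose i hi hi1 hi2 using fun n => exists_downscaled_eq (lam n) x
  -- the staircase bounds, in terms of the largest pile `m` or `m + 1` in place of `m`
  have hbounds : ∀ᶠ n in atTop,
      pile (lam n) 0 * (pile (lam n) 0 - 1) ≤ 2 * c n ∧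
        2 * c n ≤ (pile (lam n) 0 + 1) * (pile (lam n) 0 + 2) ∧
        ∀ i, pile (lam n) 0 - 1 - i ≤ pile (lam n) i ∧ pile (lam n) i ≤ pile (lam n) 0 + 1 - i := by
    filter_upwards [hqc.eventually (ge_mem_nhds (show (0 : ℝ) < 1 / 100 by norm_num)),
      eventually_ge_atTop 1] with n hn h1
    obtain ⟨m, hm1, hm2, hm⟩ := exists_pile_bounds_of_small (hq n) (hlam n h1) (by linarith)
    have h0 := hm 0
    refine ⟨?_, ?_, fun i => ?_⟩
    · refine le_trans ?_ hm1
      rw [mul_comm]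
      exact Nat.mul_le_mul (by omega) (by omega)
    · exact hm2.trans (Nat.mul_le_mul (by omega) (by omega))
    · have := hm i
      omega
  set p : ℕ → ℝ := fun n => (pile (lam n) 0 : ℝ) with hp
  have hptop : Tendsto p atTop atTop := by
    rw [hp]
    refine tendsto_natCast_atTop_atTop.comp (tendsto_atTop.2 fun b => ?_)
    filter_upwards [hbounds, hc.eventually_ge_atTop ((b + 1) * (b + 2))] with n hn hcn
    by_contra hcon
    have h1 : (pile (lam n) 0 + 1) * (pile (lam n) 0 + 2) ≤ (b + 1) * (b + 2) :=
      Nat.mul_le_mul (by omega) (by omega)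
    have h2 := hn.2.1
    have h3 : 0 < (b + 1) * (b + 2) := by positivity
    omega
  have hu : Tendsto (fun n => (p n)⁻¹) atTop (𝓝 0) := tendsto_inv_atTop_zero.comp hptop
  have hp0 : ∀ᶠ n in atTop, 1 ≤ p n := hptop.eventually_ge_atTop 1
  have hr : Tendsto (fun n => (c n : ℝ) / p n ^ 2) atTop (𝓝 (1 / 2)) := by
    have hlow : Tendsto (fun n => (1 - (p n)⁻¹) / 2) atTop (𝓝 (1 / 2)) := by
      simpa using (hu.const_sub 1).div_const 2
    have hupp : Tendsto (fun n => (1 + (p n)⁻¹) * (1 + 2 * (p n)⁻¹) / 2) atTop (𝓝 (1 / 2)) := by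
      simpa using ((hu.const_add 1).mul ((hu.const_mul 2).const_add 1)).div_const 2
    refine tendsto_of_tendsto_of_tendsto_of_le_of_le' hlow hupp ?_ ?_
    · filter_upwards [hbounds, hp0] with n hn h1
      have h2 : p n * (p n - 1) ≤ 2 * c n := by
        have h3 : 1 ≤ pile (lam n) 0 := Nat.one_le_cast.1 h1
        have h4 : ((pile (lam n) 0 * (pile (lam n) 0 - 1) : ℕ) : ℝ) ≤ (2 * c n : ℕ) := by
          exact_mod_cast hn.1
        rw [Nat.cast_mul, Nat.cast_sub h3] at h4
        push_cast at h4
        exact h4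
      have hpos : 0 < p n := by linarith
      rw [le_div_iff₀ (by positivity)]
      have h3 : (1 - (p n)⁻¹) / 2 * p n ^ 2 = p n * (p n - 1) / 2 := by field_simp
      linarith
    · filter_upwards [hbounds, hp0] with n hn h1
      have h2 : 2 * (c n : ℝ) ≤ (p n + 1) * (p n + 2) := by
        simp only [hp]
        exact_mod_cast hn.2.1
      have hpos : 0 < p n := by linarith
      rw [div_le_iff₀ (by positivity)]
      have h3 : (1 + (p n)⁻¹) * (1 + 2 * (p n)⁻¹) / 2 * p n ^ 2 = (p n + 1) * (p n + 2) / 2 := by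
        field_simp
      linarith
  have hw : Tendsto (fun n => (i n : ℝ) / p n) atTop (𝓝 (x / 2)) := by
    have hupp : Tendsto (fun n => (x : ℝ) * (c n / p n ^ 2)) atTop (𝓝 (x / 2)) := by
      simpa [div_eq_mul_inv] using hr.const_mul (x : ℝ)
    have hlow : Tendsto (fun n => (x : ℝ) * (c n / p n ^ 2) - (p n)⁻¹) atTop (𝓝 (x / 2)) := by
      simpa using hupp.sub hu
    refine tendsto_of_tendsto_of_tendsto_of_le_of_le' hlow hupp ?_ ?_
    · filter_upwards [hp0] with n h1
      have hpos : 0 < p n := by linarith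
      rw [le_div_iff₀ hpos]
      have h3 : ((x : ℝ) * (c n / p n ^ 2) - (p n)⁻¹) * p n = x * c n / p n - 1 := by field_simp
      have := hi2 n
      linarith
    · filter_upwards [hp0] with n h1
      have hpos : 0 < p n := by linarith
      rw [div_le_iff₀ hpos]
      have h3 : ((x : ℝ) * (c n / p n ^ 2)) * p n = x * c n / p n := by field_simp
      have := hi1 n
      linarith
  have hlow : Tendsto (fun n => max (1 - (p n)⁻¹ - i n / p n) 0) atTop
      (𝓝 (max (1 - (x : ℝ) / 2) 0)) := by
    simpa using ((hu.const_sub 1).sub hw).max tendsto_const_nhds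
  have hupp : Tendsto (fun n => max (1 + (p n)⁻¹ - i n / p n) 0) atTop
      (𝓝 (max (1 - (x : ℝ) / 2) 0)) := by
    simpa using ((hu.const_add 1).sub hw).max tendsto_const_nhds
  refine tendsto_of_tendsto_of_tendsto_of_le_of_le' hlow hupp ?_ ?_
  · filter_upwards [hbounds, hp0] with n hn h1
    have hpos : 0 < p n := by linarith
    rw [hi n]
    refine max_le ?_ (by positivity)
    have h2 : pile (lam n) 0 ≤ pile (lam n) (i n) + i n + 1 := by
      have := (hn.2.2 (i n)).1
      omega
    have h3 : p n ≤ pile (lam n) (i n) + i n + 1 := by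
      simp only [hp]
      exact_mod_cast h2
    rw [le_div_iff₀ hpos]
    have h4 : (1 - (p n)⁻¹ - i n / p n) * p n = p n - 1 - i n := by field_simp
    linarith
  · filter_upwards [hbounds, hp0] with n hn h1
    have hpos : 0 < p n := by linarith
    rw [hi n]
    have h2 := (hn.2.2 (i n)).2
    rcases Nat.eq_zero_or_pos (pile (lam n) (i n)) with h0 | h0
    · simp [h0]
    · refine le_max_of_le_left ?_
      have h3 : pile (lam n) (i n) + i n ≤ pile (lam n) 0 + 1 := by omega
      have h4 : (pile (lam n) (i n) : ℝ) + i n ≤ p n + 1 := by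
        simp only [hp]
        exact_mod_cast h3
      rw [div_le_iff₀ hpos]
      have h5 : (1 + (p n)⁻¹ - i n / p n) * p n = p n + 1 - i n := by field_simp
      linarith

/-- If `q → 0` and `q i → x`, then `(1 - q) ^ i → e ^ {-x}`. -/
theorem tendsto_one_sub_pow_exp {q : ℕ → ℝ} (hq : Tendsto q atTop (𝓝 0)) {i : ℕ → ℕ} {x : ℝ}
    (hi : Tendsto (fun n => q n * i n) atTop (𝓝 x)) :
    Tendsto (fun n => (1 - q n) ^ i n) atTop (𝓝 (Real.exp (-x))) := by
  have hlow : Tendsto (fun n => Real.exp (-(q n * i n / (1 - q n)))) atTop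
      (𝓝 (Real.exp (-x))) := by
    have := hi.div (hq.const_sub 1) (by norm_num)
    rw [sub_zero, div_one] at this
    exact (Real.continuous_exp.tendsto _).comp this.neg
  have hupp : Tendsto (fun n => Real.exp (-(q n * i n))) atTop (𝓝 (Real.exp (-x))) :=
    (Real.continuous_exp.tendsto _).comp hi.neg
  have hlt : ∀ᶠ n in atTop, q n < 1 := hq.eventually (gt_mem_nhds one_pos)
  refine tendsto_of_tendsto_of_tendsto_of_le_of_le' hlow hupp ?_ ?_
  · filter_upwards [hlt] with n hn
    have h0 : 0 < 1 - q n := by linarith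
    have h1 : Real.exp (-(q n * i n / (1 - q n))) = Real.exp (-(q n / (1 - q n))) ^ i n := by
      rw [← Real.exp_nat_mul]
      congr 1
      ring
    rw [h1]
    refine pow_le_pow_left₀ (Real.exp_pos _).le ?_ _
    rw [Real.exp_neg, inv_le_comm₀ (Real.exp_pos _) h0]
    refine le_trans (le_of_eq ?_) (Real.add_one_le_exp _)
    field_simp
    ring
  · filter_upwards [hlt] with n hn
    have h1 : Real.exp (-(q n * i n)) = Real.exp (-q n) ^ i n := by
      rw [← Real.exp_nat_mul]
      congr 1
      ring
    rw [h1]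
    exact pow_le_pow_left₀ (by linarith) (Real.one_sub_le_exp_neg _) _

/-- The exponential limit for recurrent configurations of `c n` cards. -/
theorem tendsto_downscaled_exponential {q : ℕ → ℝ} (hq : ∀ n, q n ∈ Set.Ioc (0 : ℝ) 1)
    {c : ℕ → ℕ} (hq0 : Tendsto q atTop (𝓝 0))
    (hqc : Tendsto (fun n => q n ^ 2 * (c n : ℝ)) atTop atTop)
    (lam : ∀ n, Nat.Partition (c n))
    (hlam : ∀ n, 1 ≤ n → (proportionRule (q n) (hq n)).IsRecurrent (lam n)) (x : ℝ≥0) :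
    Tendsto (fun n => downscaled (lam n) x) atTop (𝓝 (exponentialShape x)) := by
  rw [← NNReal.tendsto_coe]
  change Tendsto _ _ (𝓝 (Real.exp (-(x : ℝ))))
  choose i hi hi1 hi2 using fun n => exists_downscaled_eq (lam n) x
  set A : ℕ → ℝ := fun n => q n ^ 2 * (c n : ℝ) with hA
  set B : ℕ → ℝ := fun n => A n + √(4 * A n + 8) + 1 with hB
  set p : ℕ → ℝ := fun n => q n * pile (lam n) 0 with hp
  have hApos : ∀ᶠ n in atTop, 1 ≤ A n := hqc.eventually_ge_atTop 1
  have hpA : ∀ᶠ n in atTop, A n ≤ p n ∧ p n ≤ B n := by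
    filter_upwards [eventually_ge_atTop 1] with n hn
    have h1 := mul_pile_bounds (hq n) (hlam n hn) 0
    rw [pow_zero, one_mul, one_mul] at h1
    exact ⟨h1.2.2, h1.2.1⟩
  have hAinv : Tendsto (fun n => (A n)⁻¹) atTop (𝓝 0) := tendsto_inv_atTop_zero.comp hqc
  have hBA : Tendsto (fun n => B n / A n) atTop (𝓝 1) := by
    have h1 : Tendsto (fun n => 1 + √(4 * (A n)⁻¹ + 8 * (A n)⁻¹ ^ 2) + (A n)⁻¹) atTop (𝓝 1) := by
      have h2 := (Real.continuous_sqrt.tendsto _).comp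
        ((hAinv.const_mul 4).add ((hAinv.pow 2).const_mul 8))
      simpa using (h2.const_add 1).add hAinv
    refine h1.congr' ?_
    filter_upwards [hApos] with n hn
    have hpos : 0 < A n := by linarith
    have h2 : 4 * (A n)⁻¹ + 8 * (A n)⁻¹ ^ 2 = (4 * A n + 8) / A n ^ 2 := by
      field_simp
    rw [h2, Real.sqrt_div' _ (sq_nonneg _), Real.sqrt_sq hpos.le]
    simp only [hB]
    field_simp
  have hAB : Tendsto (fun n => A n / B n) atTop (𝓝 1) := by
    have := hBA.inv₀ one_ne_zero
    simpa using this
  have hAp : Tendsto (fun n => A n / p n) atTop (𝓝 1) := by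
    refine tendsto_of_tendsto_of_tendsto_of_le_of_le' hAB tendsto_const_nhds ?_ ?_
    · filter_upwards [hApos, hpA] with n h1 h2
      exact div_le_div_of_nonneg_left (by linarith) (by linarith) h2.2
    · filter_upwards [hApos, hpA] with n h1 h2
      exact div_le_one_of_le₀ h2.1 (by linarith)
  have hqi : Tendsto (fun n => q n * i n) atTop (𝓝 x) := by
    have hupp : Tendsto (fun n => (x : ℝ) * (A n / p n)) atTop (𝓝 x) := by
      simpa using hAp.const_mul (x : ℝ)
    have hlow : Tendsto (fun n => (x : ℝ) * (A n / p n) - q n) atTop (𝓝 x) := by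
      simpa using hupp.sub hq0
    have hkey : ∀ n, q n * (x * c n / pile (lam n) 0) = x * (A n / p n) := by
      intro n
      have h0 := (hq n).1.ne'
      simp only [hA, hp]
      -- without cards, both quotients are `0` by the convention on division by `0`
      rcases eq_or_ne (pile (lam n) 0 : ℝ) 0 with h1 | h1
      · simp [h1]
      · field_simp
    refine tendsto_of_tendsto_of_tendsto_of_le_of_le hlow hupp (fun n => ?_) (fun n => ?_)
    · have h1 := mul_le_mul_of_nonneg_left (hi2 n).le (hq n).1.le
      rw [hkey] at h1
      simp only
      linarith
    · have h1 := mul_le_mul_of_nonneg_left (hi1 n) (hq n).1.le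
      rwa [hkey] at h1
  have hw := tendsto_one_sub_pow_exp hq0 hqi
  have hBinv : Tendsto (fun n => (B n)⁻¹) atTop (𝓝 0) := by
    refine tendsto_inv_atTop_zero.comp (tendsto_atTop_mono (fun n => ?_) hqc)
    have := Real.sqrt_nonneg (4 * A n + 8)
    simp only [hB]
    linarith
  have hlow : Tendsto (fun n => (1 - q n) ^ i n * (A n / B n) - (B n)⁻¹) atTop
      (𝓝 (Real.exp (-(x : ℝ)))) := by
    simpa using (hw.mul hAB).sub hBinv
  have hupp : Tendsto (fun n => (1 - q n) ^ i n * (B n / A n)) atTop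
      (𝓝 (Real.exp (-(x : ℝ)))) := by
    simpa using hw.mul hBA
  have hval : ∀ n, (downscaled (lam n) x : ℝ) = q n * pile (lam n) (i n) / p n := fun n => by
    rw [hi n, hp, mul_div_mul_left _ _ (hq n).1.ne']
  refine tendsto_of_tendsto_of_tendsto_of_le_of_le' hlow hupp ?_ ?_
  · filter_upwards [hApos, hpA, eventually_ge_atTop 1] with n h1 h2 hn
    have h3 := (mul_pile_bounds (hq n) (hlam n hn) (i n)).1
    have h4 : 0 ≤ q n * pile (lam n) (i n) := mul_nonneg (hq n).1.le (Nat.cast_nonneg _)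
    rw [hval]
    refine le_trans ?_ (div_le_div_of_nonneg_left h4 (by linarith) h2.2)
    rw [← mul_div_assoc, inv_eq_one_div, ← sub_div]
    exact div_le_div_of_nonneg_right h3 (by linarith)
  · filter_upwards [hApos, hpA, eventually_ge_atTop 1] with n h1 h2 hn
    have h3 := (mul_pile_bounds (hq n) (hlam n hn) (i n)).2.1
    have h4 : 0 ≤ q n * pile (lam n) (i n) := mul_nonneg (hq n).1.le (Nat.cast_nonneg _)
    rw [hval, ← mul_div_assoc]
    exact (div_le_div_of_nonneg_left h4 (by linarith) h2.1).trans
      (div_le_div_of_nonneg_right h3 (by linarith))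

theorem IsStableLimitShape.eq {σ : ℕ → WellBehavedRule} {φ ψ : ℝ≥0 → ℝ≥0}
    (hφ : IsStableLimitShape σ φ) (hψ : IsStableLimitShape σ ψ) {x : ℝ≥0} (hx : 0 < x) :
    φ x = ψ x := by
  choose lam hlam using fun n => (σ n).exists_isStable_nStar n
  exact tendsto_nhds_unique (hφ lam (fun n _ => hlam n) x hx) (hψ lam (fun n _ => hlam n) x hx)

/-- Stable limit shapes are unique, so one common limit shape settles all of them. -/
theorem IsRecurrentLimitShape.of_isStableLimitShape {σ : ℕ → WellBehavedRule} {φ ψ : ℝ≥0 → ℝ≥0}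
    (hs : IsStableLimitShape σ ψ) (hr : IsRecurrentLimitShape σ ψ) (hφ : IsStableLimitShape σ φ) :
    IsRecurrentLimitShape σ φ := fun lam hlam x hx => by
  rw [hφ.eq hs hx]
  exact hr lam hlam x hx

theorem tendsto_nStar_atTop (σ : ℕ → WellBehavedRule) :
    Tendsto (fun n => (σ n).nStar n) atTop atTop := by
  refine tendsto_atTop.2 fun b => ?_
  filter_upwards [eventually_ge_atTop (2 * b + 1)] with n hn
  have := (σ n).le_two_mul_nStar_add_one n
  omega

theorem mainTheorem3 (q : ℕ → ℝ) (hq : ∀ n, q n ∈ Set.Ioc (0 : ℝ) 1) :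
    (Tendsto (fun n : ℕ => q n ^ 2 * (n : ℝ)) atTop (𝓝 0) →
      IsStableLimitShape (fun n => proportionRule (q n) (hq n)) triangularShape ∧
      IsRecurrentLimitShape (fun n => proportionRule (q n) (hq n)) triangularShape ∧
      ∀ φ : ℝ≥0 → ℝ≥0,
        IsStableLimitShape (fun n => proportionRule (q n) (hq n)) φ →
        IsRecurrentLimitShape (fun n => proportionRule (q n) (hq n)) φ) ∧
    (Tendsto q atTop (𝓝 0) → Tendsto (fun n : ℕ => q n ^ 2 * (n : ℝ)) atTop atTop →
      IsStableLimitShape (fun n => proportionRule (q n) (hq n)) exponentialShape ∧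
      IsRecurrentLimitShape (fun n => proportionRule (q n) (hq n)) exponentialShape ∧
      ∀ φ : ℝ≥0 → ℝ≥0,
        IsStableLimitShape (fun n => proportionRule (q n) (hq n)) φ →
        IsRecurrentLimitShape (fun n => proportionRule (q n) (hq n)) φ) := by
  set σ : ℕ → WellBehavedRule := fun n => proportionRule (q n) (hq n) with hσ
  constructor
  · intro hqn
    have hr : IsRecurrentLimitShape σ triangularShape := fun lam hlam x _ =>
      tendsto_downscaled_triangular hq tendsto_id hqn lam hlam x
    have hs : IsStableLimitShape σ triangularShape := by
      intro lam hlam x _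
      refine tendsto_downscaled_triangular hq (tendsto_nStar_atTop σ) ?_ lam
        (fun n hn => (hlam n hn).isRecurrent) x
      refine squeeze_zero (fun n => by positivity) (fun n => ?_) hqn
      exact mul_le_mul_of_nonneg_left (by exact_mod_cast (σ n).nStar_le n) (sq_nonneg _)
    exact ⟨hs, hr, fun φ hφ => .of_isStableLimitShape hs hr hφ⟩
  · intro hq0 hqn
    have hr : IsRecurrentLimitShape σ exponentialShape := fun lam hlam x _ =>
      tendsto_downscaled_exponential hq hq0 hqn lam hlam x
    have hs : IsStableLimitShape σ exponentialShape := by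
      intro lam hlam x _
      refine tendsto_downscaled_exponential hq hq0 ?_ lam
        (fun n hn => (hlam n hn).isRecurrent) x
      -- `n ≤ 2 n* + 1` and `q ^ 2 ≤ 1`
      refine tendsto_atTop_mono (fun n => ?_)
        ((tendsto_atTop_add_const_right _ (-1 : ℝ) hqn).atTop_div_const two_pos)
      have h1 : (n : ℝ) ≤ 2 * (σ n).nStar n + 1 := by
        exact_mod_cast (σ n).le_two_mul_nStar_add_one n
      have h2 := mul_le_mul_of_nonneg_left h1 (sq_nonneg (q n))
      have h3 : q n ^ 2 ≤ 1 := pow_le_one₀ (hq n).1.le (hq n).2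
      rw [div_le_iff₀ two_pos]
      linarith
    exact ⟨hs, hr, fun φ hφ => .of_isStableLimitShape hs hr hφ⟩
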